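/- For an integer $s\ge 1$, call the $s^2$ squares $\left[\frac{j_1}{s},\frac{j_1+1}{s}\right]\times\left[\frac{j_2}{s},\frac{j_2+1}{s}\right]$, $0\le j_1,j_2<s$, the $s$-squares of $[0,1]^2$. A continuous surjective curve $\gamma\colon[0,1]\to[0,1]^2$ is said to be decomposed into $s^2$ fractions if for every $k=0,\dots,s^2-1$ the image $\gamma\left(\left[\frac{k}{s^2},\frac{k+1}{s^2}\right]\right)$ is an $s$-square, and $\gamma$ is called cubically decomposable if it can be decomposed into an arbitrarily large number of fractions, that is, if it is decomposed into $s^2$ fractions for arbitrarily large $s$. The Euclidean dilation of $\gamma$ is $$\mathrm{WD}_2(\gamma)=\sup_{0\le t_1<t_2\le 1}\frac{\|\gamma(t_1)-\gamma(t_2)\|_2^2}{t_2-t_1}\in[0,\infty].$$ Theorem. There exists $\varepsilon>0$ such that every cubically decomposable curve $\gamma\colon[0,1]\to[0,1]^2$ satisfies $\mathrm{WD}_2(\gamma)\ge 4+\varepsilon$. -/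

import Mathlib

namespace CubeCurve

/-- The unit cube `[0,1]^d` in Euclidean space. -/
def unitCube (d : ℕ) : Set (EuclideanSpace ℝ (Fin d)) :=
  {x | ∀ i, 0 ≤ x i ∧ x i ≤ 1}

/-- The `s`-cube `[j₁/s, (j₁+1)/s] × ⋯ × [j_d/s, (j_d+1)/s]` of the regular grid of `s ^ d` cubes
that divides the unit cube. -/
def gridCube (d s : ℕ) (j : Fin d → Fin s) : Set (EuclideanSpace ℝ (Fin d)) :=
  {x | ∀ i, ((j i : ℕ) : ℝ) / (s : ℝ) ≤ x i ∧ x i ≤ (((j i : ℕ) : ℝ) + 1) / (s : ℝ)}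

/-- The time segment `[k/g, (k+1)/g]`. -/
def timeSegment (g k : ℕ) : Set ℝ :=
  Set.Icc ((k : ℝ) / (g : ℝ)) (((k : ℝ) + 1) / (g : ℝ))

/-- A surjective curve `γ : [0,1] → [0,1]^d`: continuous on `[0,1]`, with image exactly the unit
cube. Values of `γ` outside `[0,1]` play no role. -/
structure IsSurjectiveCurve (d : ℕ) (γ : ℝ → EuclideanSpace ℝ (Fin d)) : Prop where
  continuousOn : ContinuousOn γ (Set.Icc (0 : ℝ) 1)
  image_eq : γ '' Set.Icc (0 : ℝ) 1 = unitCube d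

/-- `γ` is decomposed into `s ^ d` fractions: each of the `s ^ d` equal time segments is mapped
onto some `s`-cube. -/
def IsDecomposed (d : ℕ) (γ : ℝ → EuclideanSpace ℝ (Fin d)) (s : ℕ) : Prop :=
  ∀ k : ℕ, k < s ^ d → ∃ j : Fin d → Fin s, γ '' timeSegment (s ^ d) k = gridCube d s j

/-- A cubically decomposable curve: a surjective curve that can be decomposed into an arbitrarily
large number of fractions. -/
structure IsCubicallyDecomposable (d : ℕ) (γ : ℝ → EuclideanSpace ℝ (Fin d)) : Prop where
  surjectiveCurve : IsSurjectiveCurve d γ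
  decomposed : ∀ N : ℕ, ∃ s : ℕ, N < s ^ d ∧ IsDecomposed d γ s

/-- The Euclidean dilation of a curve `γ : [a,b] → ℝ^d`, the supremum over `a ≤ t₁ < t₂ ≤ b` of
`‖γ t₁ - γ t₂‖ ^ d / (t₂ - t₁)`, as an extended nonnegative real (it may be `∞`). -/
noncomputable def dilation (d : ℕ) (a b : ℝ) (γ : ℝ → EuclideanSpace ℝ (Fin d)) : ENNReal :=
  ⨆ (t₁ : ℝ) (t₂ : ℝ) (_ : a ≤ t₁ ∧ t₁ < t₂ ∧ t₂ ≤ b),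
    ENNReal.ofReal (‖γ t₁ - γ t₂‖ ^ d / (t₂ - t₁))

end CubeCurve

/-!
The constant is `ε = 1 / 10`, and nine consecutive fractions suffice for the contradiction.

Suppose that `γ` is decomposed into `s ^ 2 ≥ 9` fractions and has dilation at most `4.1`. Scale
space by `s` and time by `s ^ 2`: in each of the time intervals `[k, k + 1]` the curve fills a
cell of the integer grid. The cells of consecutive fractions touch, because both contain the
position at the common time, and different fractions have different cells, because `γ` is onto
(`injective_of_isDecomposed`). The only further information that is used is that during
`[k, k + 1]` the curve visits the four corners of its cell, and that visits to `v` and `w` are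
at least `|v - w| ^ 2 / 4.1` apart in time.
So four corners in cyclic order use up at least `3 / 4.1` of the
time of a cell, an order with a diagonal step in the middle at least `4 / 4.1`, and an order with
two diagonal steps does not fit. Little slack is left for the passage from a cell to the next
ones, and the curve can also not move far away nor, as cells are not repeated, turn back too
often. In fact no nine consecutive cells satisfy these constraints, though eight cells can; this
is a finite problem.

The search (`noContinuation`) runs through the paths of cells and keeps, for every path, a list of
possible lower bounds for the times of the visits to the corners of the last two cells. For
earlier cells only the trivial bound `k` is kept, which is enough and keeps the lists short, as
does the removal of every entry whose bounds are nowhere below those of another entry. Times are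
in units in which a cell takes `41`, so that `10 * |v - w| ^ 2` is the least time between visits
and everything is a natural number. The search is evaluated by the kernel in `noContinuation_nine`
and is shown to be exhaustive in `GridTrace.noContinuation_eq_false`. By the symmetries of the
lattice the first step is taken to be `(1, 0)` or `(1, 1)` (`LatticeTrace.false`).
-/

namespace CubeCurve

/-! ### The search -/

/-- A cell of the integer grid, named by its lower left corner. Its four corners are numbered by
`c < 4`: corner `c` of the cell `s` is the point `(s.1 + c % 2, s.2 + c / 2)`. -/
abbrev Cell := ℕ × ℕ

/-- The squared difference of two natural numbers; one of the two truncated differences is `0`. -/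
def natSqDiff (a b : ℕ) : ℕ := (a - b) * (a - b) + (b - a) * (b - a)

/-- The squared distance from corner `c` of the cell `s` to corner `e` of the cell `r`. -/
def cornerSqDist (s : Cell) (c : ℕ) (r : Cell) (e : ℕ) : ℕ :=
  natSqDiff (s.1 + c % 2) (r.1 + e % 2) + natSqDiff (s.2 + c / 2) (r.2 + e / 2)

/-- Lower bounds for the times at which the four corners of one cell are visited. -/
structure Bounds where
  v0 : ℕ
  v1 : ℕ
  v2 : ℕ
  v3 : ℕ

namespace Bounds

/-- The bound for corner `c`. -/
def get (b : Bounds) (c : ℕ) : ℕ :=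
  match c with
  | 0 => b.v0
  | 1 => b.v1
  | 2 => b.v2
  | _ => b.v3

/-- The bounds given by a function of the corner. -/
def ofFn (f : ℕ → ℕ) : Bounds := ⟨f 0, f 1, f 2, f 3⟩

/-- Whether `a` is pointwise at most `b`, that is, gives the weaker constraints. -/
def le (a b : Bounds) : Bool :=
  Nat.ble a.v0 b.v0 && Nat.ble a.v1 b.v1 && Nat.ble a.v2 b.v2 && Nat.ble a.v3 b.v3

/-- Whether all four bounds are at most `h`. -/
def bounded (b : Bounds) (h : ℕ) : Bool :=
  Nat.ble b.v0 h && Nat.ble b.v1 h && Nat.ble b.v2 h && Nat.ble b.v3 h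

end Bounds

/-- What the search remembers of a partial traversal: the bounds for the last cell and, after the
first step, for the one before it. -/
abbrev State := List Bounds

/-- `force n k` is `k n`. The case distinction makes the kernel evaluate `n` to a literal before
`k` copies it. -/
def force {α : Type} (n : ℕ) (k : ℕ → α) : α :=
  match n with
  | 0 => k 0
  | m + 1 => k (m + 1)

/-- `k b`, with the entries of `b` evaluated first. -/
def Bounds.force {α : Type} (b : Bounds) (k : Bounds → α) : α :=
  CubeCurve.force b.v0 fun v0 => CubeCurve.force b.v1 fun v1 =>
    CubeCurve.force b.v2 fun v2 => CubeCurve.force b.v3 fun v3 => k ⟨v0, v1, v2, v3⟩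

/-- `k σ`, with the entries of `σ` evaluated first. -/
def forceState {α : Type} : State → (State → α) → α
  | [], k => k []
  | b :: σ, k => b.force fun b => forceState σ fun σ => k (b :: σ)

/-- The maximum of two natural numbers, in a form that the kernel evaluates quickly. -/
def fastMax (a b : ℕ) : ℕ := bif Nat.ble a b then b else a

/-- The bounds that follow from `b` if corner `c` is visited before the corners in `rem`. -/
def raise (c : ℕ) (rem : List ℕ) (b : Bounds) : Bounds :=
  Bounds.ofFn fun e =>
    bif rem.elem e then fastMax (b.get e) (b.get c + 10 * cornerSqDist (0, 0) c (0, 0) e)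
    else b.get e

/-- The improved bounds for every order in which the `n` corners in `rem` can be visited, where the
time limit `h` is not exceeded. -/
def orders (h : ℕ) : ℕ → List ℕ → Bounds → List Bounds
  | 0, _, b => [b]
  | n + 1, rem, b => rem.flatMap fun c => (raise c (rem.erase c) b).force fun b' =>
      bif b'.bounded h then orders h n (rem.erase c) b' else []

/-- The lower bound for the visit to corner `e` of the cell `r` that follows from the cells of the
path alone: the cell that is followed by `n` cells in the list is entered at time `41 * n` or
later, and each of its corners is visited after that. -/
def pathBound (r : Cell) (e : ℕ) : List Cell → ℕ
  | [] => 0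
  | s :: l => fastMax (41 * l.length + 10 * fastMax
      (fastMax (cornerSqDist s 0 r e) (cornerSqDist s 1 r e))
      (fastMax (cornerSqDist s 2 r e) (cornerSqDist s 3 r e))) (pathBound r e l)

/-- The lower bound for the visit to corner `e` of the cell `r` that follows from the bound `m` and
from the bounds in a state. -/
def stateBound (r : Cell) (e : ℕ) : List Cell → State → ℕ → ℕ
  | s :: l, b :: σ, m => stateBound r e l σ <| fastMax m <| fastMax
      (fastMax (b.v0 + 10 * cornerSqDist s 0 r e) (b.v1 + 10 * cornerSqDist s 1 r e))
      (fastMax (b.v2 + 10 * cornerSqDist s 2 r e) (b.v3 + 10 * cornerSqDist s 3 r e))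
  | _, _, m => m

/-- Whether the state `σ` gives constraints that are implied by those of `τ`. -/
def stateLe : State → State → Bool
  | a :: σ, b :: τ => a.le b && stateLe σ τ
  | [], [] => true
  | _, _ => false

/-- Adds a state to a list of states, of which only minimal ones are kept. -/
def insertState (L : List State) (σ : State) : List State :=
  bif L.any (fun τ => stateLe τ σ) then L else σ :: L.filter fun τ => !(stateLe σ τ)

/-- Adds the states of a list one by one and passes the result to `k`. -/
def insertAll {α : Type} (k : List State → α) : List State → List State → α
  | [], acc => k acc
  | σ :: L, acc => forceState σ fun σ => insertAll k L (insertState acc σ)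

/-- The states after the traversal of the path has been continued to the cell `r`, for which
`base` are known bounds and `h` is the time limit. -/
def extend (path : List Cell) (r : Cell) (base : Bounds) (h : ℕ) (L : List State) : List State :=
  L.flatMap fun σ => (Bounds.ofFn fun e => stateBound r e path σ (base.get e)).force fun b =>
    bif b.bounded h then (orders h 4 [0, 1, 2, 3] b).map fun b' => b' :: σ.take 1 else []

/-- The cells that may follow a path, whose last cell comes first in the list. The path starts at
`(10, 10)`, which keeps the first nine cells away from the truncation of subtraction at `0`, and
by symmetry its first step is one of two. -/
def nextCells : List Cell → List Cell
  | [] => [(10, 10)]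
  | [_] => [(11, 10), (11, 11)]
  | (x, y) :: _ => [(x - 1, y - 1), (x - 1, y), (x - 1, y + 1), (x, y - 1), (x, y + 1),
      (x + 1, y - 1), (x + 1, y), (x + 1, y + 1)]

/-- Whether a cell lies in a list. -/
def memCell (r : Cell) (l : List Cell) : Bool :=
  l.any fun s => Nat.beq s.1 r.1 && Nat.beq s.2 r.2

/-- Whether a path with one of the states in `L` has no continuation by `n` more cells. -/
def noContinuation : ℕ → List Cell → List State → Bool
  | 0, _, L => L.isEmpty
  | n + 1, path, L => L.isEmpty || (nextCells path).all fun r => memCell r path ||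
      force r.1 fun x => force r.2 fun y =>
      (Bounds.ofFn fun e => fastMax (41 * path.length) (pathBound (x, y) e path)).force fun base =>
      force (41 * (path.length + 1)) fun h =>
        !(base.bounded h) ||
        insertAll (noContinuation n ((x, y) :: path)) (extend path (x, y) base h L) []

/-- No path of nine cells, in normal position, admits visits to the corners of its cells that obey
the time constraints. -/
theorem noContinuation_nine : noContinuation 9 [] [[]] = true := by
  decide +kernel

/-! ### Soundness of the search -/

@[simp] theorem force_eq {α : Type} (n : ℕ) (k : ℕ → α) : force n k = k n := by
  cases n <;> rfl

@[simp] theorem Bounds.force_eq {α : Type} (b : Bounds) (k : Bounds → α) : b.force k = k b := by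
  simp [Bounds.force]

@[simp] theorem forceState_eq {α : Type} (σ : State) (k : State → α) : forceState σ k = k σ := by
  induction σ generalizing k with
  | nil => rfl
  | cons b σ ih => simp [forceState, ih]

@[simp] theorem fastMax_eq (a b : ℕ) : fastMax a b = max a b := by
  rw [fastMax]
  cases h : Nat.ble a b
  · rw [cond_false, max_eq_left]
    exact (not_le.1 fun hle => by simp [Nat.ble_eq_true_of_le hle] at h).le
  · rw [cond_true, max_eq_right (Nat.le_of_ble_eq_true h)]

@[simp] theorem insertAll_eq {α : Type} (k : List State → α) (L acc : List State) :
    insertAll k L acc = k (L.foldl insertState acc) := by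
  induction L generalizing acc with
  | nil => rfl
  | cons σ L ih => simp [insertAll, ih]

theorem natSqDiff_cast (a b : ℕ) : ((natSqDiff a b : ℕ) : ℤ) = ((a : ℤ) - b) ^ 2 := by
  rcases le_total a b with h | h
  · simp only [natSqDiff, Nat.sub_eq_zero_of_le h]
    push_cast [Nat.cast_sub h]; ring
  · simp only [natSqDiff, Nat.sub_eq_zero_of_le h]
    push_cast [Nat.cast_sub h]; ring

theorem natSqDiff_add_left (x a b : ℕ) : natSqDiff (x + a) (x + b) = natSqDiff a b := by
  simp only [natSqDiff, Nat.add_sub_add_left]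

theorem cornerSqDist_self (s : Cell) (c e : ℕ) :
    cornerSqDist s c s e = cornerSqDist (0, 0) c (0, 0) e := by
  simp [cornerSqDist, natSqDiff_add_left]

theorem Bounds.get_ofFn (f : ℕ → ℕ) {c : ℕ} (hc : c < 4) : (Bounds.ofFn f).get c = f c := by
  interval_cases c <;> rfl

theorem Bounds.get_le_of_le {a b : Bounds} (h : a.le b = true) (c : ℕ) : a.get c ≤ b.get c := by
  simp only [Bounds.le, Bool.and_eq_true, Nat.ble_eq] at h
  rcases h with ⟨⟨⟨h0, h1⟩, h2⟩, h3⟩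
  match c with
  | 0 => exact h0
  | 1 => exact h1
  | 2 => exact h2
  | _ + 3 => exact h3

theorem Bounds.bounded_of_get_le {b : Bounds} {h : ℕ} (H : ∀ c < 4, b.get c ≤ h) :
    b.bounded h = true := by
  simp only [Bounds.bounded, Bool.and_eq_true, Nat.ble_eq]
  exact ⟨⟨⟨H 0 (by norm_num), H 1 (by norm_num)⟩, H 2 (by norm_num)⟩, H 3 (by norm_num)⟩

/-- The visits of a curve to the corners of nine consecutive cells of the grid, in normal position:
`p k` is the `k`-th cell and `T k c` is the time of a visit to its corner `c` during its traversal.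
Time is scaled so that a cell takes `41` units; a distance `d` takes at least `10 * d ^ 2`. -/
structure GridTrace (p : ℕ → Cell) (T : ℕ → ℕ → ℝ) : Prop where
  zero : p 0 = (10, 10)
  one : p 1 = (11, 10) ∨ p 1 = (11, 11)
  next : ∀ k, 0 < k → k < 8 → p (k + 1) ∈ p k :: nextCells [p k, p (k - 1)]
  inj : ∀ k < 9, ∀ l < 9, p k = p l → k = l
  le_time : ∀ k : ℕ, k < 9 → ∀ c < 4, 41 * (k : ℝ) ≤ T k c
  time_le : ∀ k : ℕ, k < 9 → ∀ c < 4, T k c ≤ 41 * ((k : ℝ) + 1)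
  dist_le : ∀ k < 9, ∀ l < 9, ∀ c < 4, ∀ e < 4,
    10 * (cornerSqDist (p k) c (p l) e : ℝ) ≤ |T l e - T k c|

/-- The numbers in `b` are lower bounds for the times in `t`. -/
def Bounds.Below (b : Bounds) (t : ℕ → ℝ) : Prop := ∀ c < 4, (b.get c : ℝ) ≤ t c

/-- The list consists of the first cells of `p`, the last one first. -/
def Follows (p : ℕ → Cell) : List Cell → Prop
  | [] => True
  | s :: l => s = p l.length ∧ Follows p l

/-- The bounds in a state hold for the last of the first `n` cells, the last but one, and so on. -/
def State.Holds (T : ℕ → ℕ → ℝ) : ℕ → State → Prop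
  | n + 1, b :: σ => b.Below (T n) ∧ State.Holds T n σ
  | _, _ => True

theorem State.Holds.mono {T : ℕ → ℕ → ℝ} {n : ℕ} {σ τ : State} (h : stateLe σ τ = true)
    (hτ : State.Holds T n τ) : State.Holds T n σ := by
  induction n generalizing σ τ with
  | zero => simp [State.Holds]
  | succ n ih =>
    match σ, τ, h, hτ with
    | [], _, _, _ => simp [State.Holds]
    | a :: σ, b :: τ, h, hτ =>
      simp only [stateLe, Bool.and_eq_true] at h
      exact ⟨fun c hc => (Nat.cast_le.2 (Bounds.get_le_of_le h.1 c)).trans (hτ.1 c hc),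
        ih h.2 hτ.2⟩

theorem State.Holds.take_one {T : ℕ → ℕ → ℝ} {n : ℕ} {σ : State} (h : State.Holds T n σ) :
    State.Holds T n (σ.take 1) := by
  match n, σ, h with
  | 0, _, _ => simp [State.Holds]
  | _ + 1, [], _ => simp [State.Holds]
  | n + 1, b :: σ, h => exact ⟨h.1, by cases n <;> simp [State.Holds]⟩

theorem exists_mem_insertState {T : ℕ → ℕ → ℝ} {n : ℕ} {L : List State} {σ : State}
    (h : ∃ τ ∈ σ :: L, State.Holds T n τ) : ∃ τ ∈ insertState L σ, State.Holds T n τ := by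
  obtain ⟨τ, hmem, hτ⟩ := h
  unfold insertState
  by_cases hd : L.any (fun τ => stateLe τ σ) = true
  · rw [hd, cond_true]
    rcases List.mem_cons.1 hmem with rfl | hmem
    · obtain ⟨τ', hτ', hle⟩ := List.any_eq_true.1 hd
      exact ⟨τ', hτ', hτ.mono hle⟩
    · exact ⟨τ, hmem, hτ⟩
  · rw [Bool.not_eq_true] at hd
    rw [hd, cond_false]
    rcases List.mem_cons.1 hmem with rfl | hmem
    · exact ⟨τ, by simp, hτ⟩
    · by_cases hle : stateLe σ τ = true
      · exact ⟨σ, by simp, hτ.mono hle⟩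
      · exact ⟨τ, List.mem_cons_of_mem _ (List.mem_filter.2 ⟨hmem, by simpa using hle⟩), hτ⟩

theorem exists_mem_foldl_insertState {T : ℕ → ℕ → ℝ} {n : ℕ} {L acc : List State}
    (h : ∃ τ ∈ L ++ acc, State.Holds T n τ) :
    ∃ τ ∈ L.foldl insertState acc, State.Holds T n τ := by
  induction L generalizing acc with
  | nil => simpa using h
  | cons σ L ih =>
    obtain ⟨τ, hmem, hτ⟩ := h
    refine ih ?_
    have hcase : τ ∈ L ∨ τ ∈ σ :: acc := by
      simp only [List.cons_append, List.mem_cons, List.mem_append] at hmem ⊢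
      tauto
    rcases hcase with h | h
    · exact ⟨τ, by simp [h], hτ⟩
    · obtain ⟨τ', h', hτ'⟩ := exists_mem_insertState ⟨τ, h, hτ⟩
      exact ⟨τ', by simp [h'], hτ'⟩

section Sound

variable {p : ℕ → Cell} {T : ℕ → ℕ → ℝ}

/-- Corners of different cells are visited in the order of the cells. -/
theorem GridTrace.add_le (h : GridTrace p T) {k l c e : ℕ} (hkl : k < l) (hl : l < 9) (hc : c < 4)
    (he : e < 4) : T k c + 10 * (cornerSqDist (p k) c (p l) e : ℝ) ≤ T l e := by
  have h1 := h.time_le k (by omega) c hc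
  have h2 := h.le_time l hl e he
  have h3 := h.dist_le k (by omega) l hl c hc e he
  have h4 : (k : ℝ) + 1 ≤ l := by exact_mod_cast hkl
  rw [abs_of_nonneg (by linarith)] at h3
  linarith

theorem GridTrace.pathBound_le (h : GridTrace p T) {n e : ℕ} (hn : n < 9) (he : e < 4)
    {l : List Cell} (hl : l.length ≤ n) (hf : Follows p l) :
    (pathBound (p n) e l : ℝ) ≤ T n e := by
  induction l with
  | nil =>
    have := h.le_time n hn e he
    simp only [pathBound, Nat.cast_zero]
    exact le_trans (by positivity) this
  | cons s l ih =>
    rw [List.length_cons] at hl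
    have key : ∀ c < 4, 41 * (l.length : ℝ) + 10 * (cornerSqDist s c (p n) e : ℝ) ≤ T n e := by
      intro c hc
      have h1 := h.le_time l.length (by omega) c hc
      have h2 := h.add_le (k := l.length) (l := n) (by omega) hn hc he
      rw [hf.1]
      linarith
    have ih := ih (by omega) hf.2
    have k0 := key 0 (by norm_num)
    have k1 := key 1 (by norm_num)
    have k2 := key 2 (by norm_num)
    have k3 := key 3 (by norm_num)
    simp only [pathBound, fastMax_eq]
    push_cast
    refine max_le ?_ ih
    rw [← le_sub_iff_add_le', ← le_div_iff₀' (by norm_num)]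
    refine max_le (max_le ?_ ?_) (max_le ?_ ?_) <;> rw [le_div_iff₀' (by norm_num)] <;> linarith

theorem GridTrace.stateBound_le (h : GridTrace p T) {n e : ℕ} (hn : n < 9) (he : e < 4)
    {l : List Cell} (hl : l.length ≤ n) (hf : Follows p l) {σ : State}
    (hσ : State.Holds T l.length σ) {m : ℕ} (hm : (m : ℝ) ≤ T n e) :
    (stateBound (p n) e l σ m : ℝ) ≤ T n e := by
  induction l generalizing σ m with
  | nil => simpa [stateBound] using hm
  | cons s l ih =>
    rw [List.length_cons] at hl
    match σ, hσ with
    | [], _ => simpa [stateBound] using hm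
    | b :: σ, hσ =>
      have key : ∀ c < 4, (b.get c : ℝ) + 10 * (cornerSqDist s c (p n) e : ℝ) ≤ T n e := by
        intro c hc
        have h1 := hσ.1 c hc
        have h2 := h.add_le (k := l.length) (l := n) (by omega) hn hc he
        rw [hf.1]
        linarith
      refine ih (by omega) hf.2 hσ.2 ?_
      simp only [fastMax_eq]
      push_cast
      exact max_le hm (max_le (max_le (key 0 (by norm_num)) (key 1 (by norm_num)))
        (max_le (key 2 (by norm_num)) (key 3 (by norm_num))))

/-- One of the bounds found by `orders` is correct: the one for the order of the actual visits. -/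
theorem GridTrace.exists_mem_orders (h : GridTrace p T) {n : ℕ} (hn : n < 9) {m : ℕ}
    {rem : List ℕ} (hm : rem.length = m) (hrem : ∀ c ∈ rem, c < 4) {b : Bounds}
    (hb : b.Below (T n)) : ∃ b' ∈ orders (41 * (n + 1)) m rem b, b'.Below (T n) := by
  induction m generalizing rem b with
  | zero => exact ⟨b, by simp [orders], hb⟩
  | succ m ih =>
    have hne : rem.toFinset.Nonempty := by
      rw [List.toFinset_nonempty_iff]
      rintro rfl
      simp at hm
    obtain ⟨c, hc, hmin⟩ := rem.toFinset.exists_min_image (T n) hne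
    rw [List.mem_toFinset] at hc
    have hr : (raise c (rem.erase c) b).Below (T n) := by
      intro e he
      rw [raise, Bounds.get_ofFn _ he]
      by_cases hmem : (rem.erase c).elem e = true
      · rw [hmem, cond_true, fastMax_eq]
        push_cast
        refine max_le (hb e he) ?_
        have h1 := h.dist_le n hn n hn c (hrem c hc) e he
        have h2 := hmin e (List.mem_toFinset.2 (List.mem_of_mem_erase (by simpa using hmem)))
        have h3 := hb c (hrem c hc)
        rw [abs_of_nonneg (by linarith), cornerSqDist_self] at h1
        linarith
      · rw [Bool.not_eq_true] at hmem
        rw [hmem, cond_false]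
        exact hb e he
    have hbd : (raise c (rem.erase c) b).bounded (41 * (n + 1)) = true := by
      refine Bounds.bounded_of_get_le fun e he => ?_
      have := (hr e he).trans (h.time_le n hn e he)
      exact_mod_cast this
    obtain ⟨b', hb', hT⟩ := ih (rem := rem.erase c)
      (by rw [List.length_erase_of_mem hc, hm]; rfl)
      (fun e he => hrem e (List.mem_of_mem_erase he)) hr
    refine ⟨b', ?_, hT⟩
    rw [orders, List.mem_flatMap]
    refine ⟨c, hc, ?_⟩
    rw [Bounds.force_eq, hbd, cond_true]
    exact hb'

theorem GridTrace.exists_mem_extend (h : GridTrace p T) {path : List Cell} (hn : path.length < 9)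
    (hf : Follows p path) {base : Bounds} (hbase : base.Below (T path.length)) {L : List State}
    (hL : ∃ σ ∈ L, State.Holds T path.length σ) :
    ∃ σ ∈ extend path (p path.length) base (41 * (path.length + 1)) L,
      State.Holds T (path.length + 1) σ := by
  obtain ⟨σ, hσL, hσ⟩ := hL
  set b := Bounds.ofFn fun e => stateBound (p path.length) e path σ (base.get e) with hbdef
  have hb : b.Below (T path.length) := by
    intro e he
    rw [hbdef, Bounds.get_ofFn _ he]
    exact h.stateBound_le hn he le_rfl hf hσ (hbase e he)
  have hbd : b.bounded (41 * (path.length + 1)) = true := by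
    refine Bounds.bounded_of_get_le fun e he => ?_
    have := (hb e he).trans (h.time_le _ hn e he)
    exact_mod_cast this
  obtain ⟨b', hb', hT⟩ := h.exists_mem_orders hn (m := 4) (rem := [0, 1, 2, 3]) rfl (by simp) hb
  refine ⟨b' :: σ.take 1, ?_, hT, hσ.take_one⟩
  rw [extend, List.mem_flatMap]
  refine ⟨σ, hσL, ?_⟩
  rw [Bounds.force_eq, ← hbdef, hbd, cond_true]
  exact List.mem_map.2 ⟨b', hb', rfl⟩

theorem Follows.exists_of_memCell {r : Cell} {l : List Cell} (hf : Follows p l)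
    (hr : memCell r l = true) : ∃ k < l.length, r = p k := by
  induction l with
  | nil => simp [memCell] at hr
  | cons s l ih =>
    simp only [memCell, List.any_cons, Bool.or_eq_true, Bool.and_eq_true, Nat.beq_eq] at hr
    rcases hr with hr | hr
    · exact ⟨l.length, by simp, by rw [← hf.1]; exact (Prod.ext hr.1 hr.2).symm⟩
    · obtain ⟨k, hk, he⟩ := ih hf.2 (by simpa [memCell] using hr)
      exact ⟨k, by simp; omega, he⟩

theorem GridTrace.mem_nextCells (h : GridTrace p T) {path : List Cell} (hn : path.length < 9)
    (hf : Follows p path) : p path.length ∈ nextCells path := by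
  match path, hn, hf with
  | [], _, _ => simp [nextCells, h.zero]
  | [s], _, _ => simpa [nextCells] using h.one
  | s :: t :: l, hn, hf =>
    simp only [List.length_cons] at hn ⊢
    have hs : s = p (l.length + 1) := hf.1
    have h1 := h.next (l.length + 1) (by omega) (by omega)
    rcases List.mem_cons.1 h1 with h1 | h1
    · have := h.inj _ (by omega) _ (by omega) h1
      omega
    · rw [← hs] at h1
      exact h1

theorem GridTrace.noContinuation_eq_false (h : GridTrace p T) {n : ℕ} {path : List Cell}
    (hn : path.length + n = 9) (hf : Follows p path) {L : List State}
    (hL : ∃ σ ∈ L, State.Holds T path.length σ) : noContinuation n path L = false := by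
  have hne : L.isEmpty = false := by
    obtain ⟨σ, hσ, -⟩ := hL
    cases L with
    | nil => simp at hσ
    | cons => rfl
  induction n generalizing path L with
  | zero => exact hne
  | succ n ih =>
    have hlt : path.length < 9 := by omega
    rw [noContinuation, hne, Bool.false_or, ← Bool.not_eq_true, List.all_eq_true]
    intro hall
    have hr := hall _ (h.mem_nextCells hlt hf)
    have hmem : memCell (p path.length) path = false := by
      rw [← Bool.not_eq_true]
      intro hm
      obtain ⟨k, hk, he⟩ := hf.exists_of_memCell hm
      have := h.inj _ hlt _ (hk.trans hlt) he
      omega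
    simp only [hmem, Bool.false_or, force_eq, Bounds.force_eq, Prod.mk.eta, insertAll_eq] at hr
    set base := Bounds.ofFn fun e =>
      fastMax (41 * path.length) (pathBound (p path.length) e path) with hbase
    have hb : base.Below (T path.length) := by
      intro e he
      rw [hbase, Bounds.get_ofFn _ he, fastMax_eq]
      push_cast
      exact max_le (h.le_time _ hlt e he) (h.pathBound_le hlt he le_rfl hf)
    have hbd : base.bounded (41 * (path.length + 1)) = true := by
      refine Bounds.bounded_of_get_le fun e he => ?_
      have := (hb e he).trans (h.time_le _ hlt e he)
      exact_mod_cast this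
    rw [hbd, Bool.not_true, Bool.false_or] at hr
    have hex := exists_mem_foldl_insertState (acc := [])
      (by simpa using h.exists_mem_extend hlt hf hb hL)
    have hff := ih (path := p path.length :: path) (by simp; omega) ⟨rfl, hf⟩ hex ?_
    · rw [hff] at hr
      exact Bool.false_ne_true hr
    · obtain ⟨σ, hσ, -⟩ := hex
      cases hc : List.foldl insertState []
          (extend path (p path.length) base (41 * (path.length + 1)) L) with
      | nil => rw [hc] at hσ; simp at hσ
      | cons => rfl

theorem GridTrace.false (h : GridTrace p T) : False := by
  have := h.noContinuation_eq_false (n := 9) (path := []) (L := [[]]) rfl trivial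
    ⟨[], by simp, trivial⟩
  rw [noContinuation_nine] at this
  exact Bool.noConfusion this

end Sound

/-! ### Normal position -/

/-- The point `v` is a corner of the unit cell of `ℤ²` with lower left corner `q`. -/
def IsCorner (q v : ℤ × ℤ) : Prop :=
  (v.1 = q.1 ∨ v.1 = q.1 + 1) ∧ (v.2 = q.2 ∨ v.2 = q.2 + 1)

/-- Two cells of `ℤ²` meet, possibly in a single corner. -/
def Touches (q r : ℤ × ℤ) : Prop := |q.1 - r.1| ≤ 1 ∧ |q.2 - r.2| ≤ 1

/-- The squared Euclidean distance of two lattice points. -/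
def latticeSqDist (v w : ℤ × ℤ) : ℤ := (v.1 - w.1) ^ 2 + (v.2 - w.2) ^ 2

/-- The visits of a curve to the corners of nine consecutive lattice cells: `q k` is the `k`-th
cell, and `T k v` is the time of a visit to its corner `v` during its traversal, in the units used
for `GridTrace`. -/
structure LatticeTrace (q : ℕ → ℤ × ℤ) (T : ℕ → ℤ × ℤ → ℝ) : Prop where
  touches : ∀ k < 8, Touches (q k) (q (k + 1))
  inj : ∀ k : ℕ, k < 9 → ∀ l < 9, q k = q l → k = l
  le_time : ∀ k : ℕ, k < 9 → ∀ v, IsCorner (q k) v → 41 * (k : ℝ) ≤ T k v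
  time_le : ∀ k : ℕ, k < 9 → ∀ v, IsCorner (q k) v → T k v ≤ 41 * ((k : ℝ) + 1)
  dist_le : ∀ k : ℕ, k < 9 → ∀ l < 9, ∀ v w, IsCorner (q k) v → IsCorner (q l) w →
    10 * (latticeSqDist v w : ℝ) ≤ |T l w - T k v|

/-- A lattice trace is moved by an isometry of the lattice with inverse `φ`, which acts on cells
by `ψ`. -/
theorem LatticeTrace.map {q : ℕ → ℤ × ℤ} {T : ℕ → ℤ × ℤ → ℝ} (h : LatticeTrace q T)
    {φ ψ : ℤ × ℤ → ℤ × ℤ} (hψ : Function.Injective ψ)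
    (htouch : ∀ r s, Touches r s → Touches (ψ r) (ψ s))
    (hcorner : ∀ r v, IsCorner (ψ r) v → IsCorner r (φ v))
    (hdist : ∀ v w, latticeSqDist (φ v) (φ w) = latticeSqDist v w) :
    LatticeTrace (fun k => ψ (q k)) (fun k v => T k (φ v)) where
  touches k hk := htouch _ _ (h.touches k hk)
  inj k hk l hl e := h.inj k hk l hl (hψ e)
  le_time k hk v hv := h.le_time k hk _ (hcorner _ _ hv)
  time_le k hk v hv := h.time_le k hk _ (hcorner _ _ hv)
  dist_le k hk l hl v w hv hw := by
    rw [← hdist]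
    exact h.dist_le k hk l hl _ _ (hcorner _ _ hv) (hcorner _ _ hw)

theorem LatticeTrace.translate {q : ℕ → ℤ × ℤ} {T : ℕ → ℤ × ℤ → ℝ} (h : LatticeTrace q T)
    (a b : ℤ) :
    LatticeTrace (fun k => ((q k).1 + a, (q k).2 + b)) (fun k v => T k (v.1 - a, v.2 - b)) := by
  refine h.map (φ := fun v => (v.1 - a, v.2 - b)) (ψ := fun r => (r.1 + a, r.2 + b)) ?_ ?_ ?_ ?_
  · intro r s hrs
    simpa [Prod.ext_iff] using hrs
  · intro r s hrs
    simpa [Touches] using hrs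
  · intro r v hv
    simp only [IsCorner] at hv ⊢
    omega
  · intro v w
    simp only [latticeSqDist]
    ring

theorem LatticeTrace.swap {q : ℕ → ℤ × ℤ} {T : ℕ → ℤ × ℤ → ℝ} (h : LatticeTrace q T) :
    LatticeTrace (fun k => ((q k).2, (q k).1)) (fun k v => T k (v.2, v.1)) := by
  refine h.map (φ := fun v => (v.2, v.1)) (ψ := fun r => (r.2, r.1)) ?_ ?_ ?_ ?_
  · intro r s hrs
    simp only [Prod.mk.injEq] at hrs
    exact Prod.ext hrs.2 hrs.1
  · intro r s hrs
    exact hrs.symm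
  · intro r v hv
    exact hv.symm
  · intro v w
    simp only [latticeSqDist]
    ring

theorem LatticeTrace.reflect {q : ℕ → ℤ × ℤ} {T : ℕ → ℤ × ℤ → ℝ} (h : LatticeTrace q T) :
    LatticeTrace (fun k => (-(q k).1 - 1, (q k).2)) (fun k v => T k (-v.1, v.2)) := by
  refine h.map (φ := fun v => (-v.1, v.2)) (ψ := fun r => (-r.1 - 1, r.2)) ?_ ?_ ?_ ?_
  · intro r s hrs
    simpa [Prod.ext_iff] using hrs
  · intro r s hrs
    simp only [Touches, abs_le] at hrs ⊢
    omega
  · intro r v hv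
    simp only [IsCorner] at hv ⊢
    omega
  · intro v w
    simp only [latticeSqDist]
    ring

/-- A lattice trace in normal position gives a grid trace. -/
theorem LatticeTrace.false_of_normal {q : ℕ → ℤ × ℤ} {T : ℕ → ℤ × ℤ → ℝ} (h : LatticeTrace q T)
    (h0 : q 0 = (10, 10)) (h1 : q 1 = (11, 10) ∨ q 1 = (11, 11)) : False := by
  have hnear : ∀ k : ℕ, k < 9 → 10 - (k : ℤ) ≤ (q k).1 ∧ 10 - (k : ℤ) ≤ (q k).2 := by
    intro k
    induction k with
    | zero => simp [h0]
    | succ k ih =>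
      intro hk
      have := ih (by omega)
      have ht := h.touches k (by omega)
      simp only [Touches, abs_le] at ht
      push_cast
      omega
  let p : ℕ → Cell := fun k => ((q k).1.toNat, (q k).2.toNat)
  let pt : ℕ → ℕ → ℤ × ℤ := fun k c => ((q k).1 + (c % 2 : ℕ), (q k).2 + (c / 2 : ℕ))
  have hp1 : ∀ k : ℕ, k < 9 → ((p k).1 : ℤ) = (q k).1 := fun k hk =>
    Int.toNat_of_nonneg (by have := (hnear k hk).1; omega)
  have hp2 : ∀ k : ℕ, k < 9 → ((p k).2 : ℤ) = (q k).2 := fun k hk =>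
    Int.toNat_of_nonneg (by have := (hnear k hk).2; omega)
  have hpt : ∀ k, ∀ c < 4, IsCorner (q k) (pt k c) := by
    intro k c hc
    simp only [IsCorner, pt]
    omega
  refine GridTrace.false (p := p) (T := fun k c => T k (pt k c)) ⟨?_, ?_, ?_, ?_, ?_, ?_, ?_⟩
  · simp [p, h0]
  · rcases h1 with h1 | h1 <;> simp [p, h1]
  · intro k hk0 hk
    have a1 := hp1 k (by omega)
    have a2 := hp2 k (by omega)
    have b1 := hp1 (k + 1) (by omega)
    have b2 := hp2 (k + 1) (by omega)
    have hn := hnear k (by omega)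
    have ht := h.touches k hk
    simp only [Touches, abs_le] at ht
    rw [← a1, ← a2, ← b1, ← b2] at ht
    rw [← a1, ← a2] at hn
    generalize p k = r at *
    generalize p (k + 1) = s at *
    obtain ⟨x, y⟩ := r
    obtain ⟨x', y'⟩ := s
    simp only [nextCells, List.mem_cons, List.not_mem_nil, Prod.mk.injEq] at *
    omega
  · intro k hk l hl e
    refine h.inj k hk l hl (Prod.ext ?_ ?_)
    · rw [← hp1 k hk, ← hp1 l hl, e]
    · rw [← hp2 k hk, ← hp2 l hl, e]
  · exact fun k hk c hc => h.le_time k hk _ (hpt k c hc)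
  · exact fun k hk c hc => h.time_le k hk _ (hpt k c hc)
  · intro k hk l hl c hc e he
    have := h.dist_le k hk l hl _ _ (hpt k c hc) (hpt l e he)
    have hd : (cornerSqDist (p k) c (p l) e : ℤ) = latticeSqDist (pt k c) (pt l e) := by
      rw [cornerSqDist, Nat.cast_add, natSqDiff_cast, natSqDiff_cast]
      push_cast
      rw [hp1 k hk, hp1 l hl, hp2 k hk, hp2 l hl]
      simp [latticeSqDist, pt]
    rw [← hd] at this
    exact_mod_cast this

theorem LatticeTrace.false {q : ℕ → ℤ × ℤ} {T : ℕ → ℤ × ℤ → ℝ} (h : LatticeTrace q T) : False := by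
  wlog hx : (q 0).1 ≤ (q 1).1 generalizing q T
  · exact this h.reflect (by simp only; omega)
  wlog hxy : (q 1).2 - (q 0).2 ≤ (q 1).1 - (q 0).1 generalizing q T
  · exact this h.swap (by simp only; omega) (by simp only; omega)
  wlog hy : (q 0).2 ≤ (q 1).2 generalizing q T
  · -- Reflection in the second coordinate can only fail to preserve `hxy` for a step `(0, -1)`.
    by_cases hc : (q 0).2 - (q 1).2 ≤ (q 1).1 - (q 0).1
    · exact this h.swap.reflect.swap hx (by simp only; omega) (by simp only; omega)
    · exact this h.swap.reflect (by simp only; omega) (by simp only; omega) (by simp only; omega)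
  have ht := h.touches 0 (by norm_num)
  simp only [Touches, abs_le, zero_add] at ht
  have hne : ¬((q 1).1 = (q 0).1 ∧ (q 1).2 = (q 0).2) := fun e => by
    have := h.inj 1 (by norm_num) 0 (by norm_num) (Prod.ext e.1 e.2)
    omega
  refine (h.translate (10 - (q 0).1) (10 - (q 0).2)).false_of_normal (by simp) ?_
  simp only [Prod.mk.injEq]
  omega

/-! ### From the curve to the lattice -/

theorem mul_coord_mem_of_mem_gridCube {s : ℕ} (hs : 0 < s) {x : EuclideanSpace ℝ (Fin 2)}
    {j : Fin 2 → Fin s} (hx : x ∈ gridCube 2 s j) (i : Fin 2) :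
    ((j i : ℕ) : ℝ) ≤ s * x i ∧ s * x i ≤ ((j i : ℕ) : ℝ) + 1 := by
  have hs' : (0 : ℝ) < s := by exact_mod_cast hs
  have := hx i
  rw [div_le_iff₀' hs', le_div_iff₀' hs'] at this
  exact this

/-- The fractions of a decomposition are mapped onto different cells: every cell is hit in its
centre, and there are as many cells as fractions. -/
theorem injective_of_isDecomposed {γ : ℝ → EuclideanSpace ℝ (Fin 2)} (hγ : IsSurjectiveCurve 2 γ)
    {s : ℕ} (hs : 0 < s) {j : Fin (s ^ 2) → Fin 2 → Fin s}
    (hj : ∀ k : Fin (s ^ 2), γ '' timeSegment (s ^ 2) k = gridCube 2 s (j k)) :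
    Function.Injective j := by
  have hs' : (0 : ℝ) < s := by exact_mod_cast hs
  refine ((Fintype.bijective_iff_surjective_and_card j).2 ⟨fun c => ?_, by simp⟩).1
  have hmem : (WithLp.toLp 2 fun i => ((c i : ℕ) + 1 / 2 : ℝ) / s) ∈ unitCube 2 := by
    intro i
    have : ((c i : ℕ) : ℝ) + 1 ≤ s := by exact_mod_cast (c i).2
    refine ⟨by positivity, ?_⟩
    rw [PiLp.toLp_apply, div_le_one hs']
    linarith
  rw [← hγ.image_eq] at hmem
  obtain ⟨t, ht, htc⟩ := hmem
  have hg : (0 : ℝ) < ((s ^ 2 : ℕ) : ℝ) := by positivity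
  obtain ⟨k, hk⟩ : ∃ k : Fin (s ^ 2), t ∈ timeSegment (s ^ 2) k := by
    -- At `t = 1` the floor of `t * s ^ 2` is one too large for the number of a fraction.
    rcases ht.2.eq_or_lt with rfl | h1
    · refine ⟨⟨s ^ 2 - 1, by have := pow_pos hs 2; omega⟩, ?_⟩
      have h1 : 1 ≤ s ^ 2 := pow_pos hs 2
      simp only [timeSegment, Set.mem_Icc]
      rw [div_le_iff₀ hg, le_div_iff₀ hg, Nat.cast_sub h1]
      constructor <;> push_cast <;> linarith
    · have hn : 0 ≤ t * ((s ^ 2 : ℕ) : ℝ) := mul_nonneg ht.1 hg.le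
      refine ⟨⟨⌊t * ((s ^ 2 : ℕ) : ℝ)⌋₊, ?_⟩, ?_⟩
      · rw [Nat.floor_lt hn]
        nlinarith
      · simp only [timeSegment, Set.mem_Icc]
        rw [div_le_iff₀ hg, le_div_iff₀ hg]
        exact ⟨Nat.floor_le hn, (Nat.lt_floor_add_one _).le⟩
  refine ⟨k, funext fun i => ?_⟩
  have hx : γ t ∈ gridCube 2 s (j k) := by
    rw [← hj k]
    exact ⟨t, hk, rfl⟩
  have := mul_coord_mem_of_mem_gridCube hs hx i
  rw [htc, PiLp.toLp_apply, mul_div_cancel₀ _ hs'.ne'] at this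
  have h1 : ((j k i : ℕ) : ℝ) < (c i : ℕ) + 1 := by linarith
  have h2 : ((c i : ℕ) : ℝ) < (j k i : ℕ) + 1 := by linarith
  have h1' : (j k i : ℕ) < (c i : ℕ) + 1 := by exact_mod_cast h1
  have h2' : (c i : ℕ) < (j k i : ℕ) + 1 := by exact_mod_cast h2
  exact Fin.ext (by omega)

/-- The cells of consecutive fractions touch, as they share the position at the common time. -/
theorem abs_sub_le_one_of_common {s : ℕ} (hs : 0 < s) {x : EuclideanSpace ℝ (Fin 2)}
    {j l : Fin 2 → Fin s} (hj : x ∈ gridCube 2 s j) (hl : x ∈ gridCube 2 s l) (i : Fin 2) :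
    |((j i : ℕ) : ℤ) - (l i : ℕ)| ≤ 1 := by
  have h1 := mul_coord_mem_of_mem_gridCube hs hj i
  have h2 := mul_coord_mem_of_mem_gridCube hs hl i
  have h3 : ((j i : ℕ) : ℝ) ≤ (l i : ℕ) + 1 := by linarith
  have h4 : ((l i : ℕ) : ℝ) ≤ (j i : ℕ) + 1 := by linarith
  have h3' : (j i : ℕ) ≤ (l i : ℕ) + 1 := by exact_mod_cast h3
  have h4' : (l i : ℕ) ≤ (j i : ℕ) + 1 := by exact_mod_cast h4
  rw [abs_le]
  omega

theorem norm_sq_le_of_dilation_le {γ : ℝ → EuclideanSpace ℝ (Fin 2)} {W : ℝ} (hW : 0 ≤ W)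
    (h : dilation 2 0 1 γ ≤ ENNReal.ofReal W) {t u : ℝ} (ht : 0 ≤ t) (htu : t ≤ u) (hu : u ≤ 1) :
    ‖γ t - γ u‖ ^ 2 ≤ W * (u - t) := by
  rcases htu.eq_or_lt with rfl | hlt
  · simp
  · have h1 : ENNReal.ofReal (‖γ t - γ u‖ ^ 2 / (u - t)) ≤ ENNReal.ofReal W := by
      refine le_trans ?_ h
      exact le_iSup₂_of_le t u (le_iSup_of_le (⟨ht, hlt, hu⟩ : 0 ≤ t ∧ t < u ∧ u ≤ 1) le_rfl)
    rw [ENNReal.ofReal_le_ofReal_iff hW, div_le_iff₀ (by linarith)] at h1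
    exact h1

theorem norm_sq_le_mul_abs_of_dilation_le {γ : ℝ → EuclideanSpace ℝ (Fin 2)} {W : ℝ} (hW : 0 ≤ W)
    (h : dilation 2 0 1 γ ≤ ENNReal.ofReal W) {t u : ℝ} (ht : t ∈ Set.Icc (0 : ℝ) 1)
    (hu : u ∈ Set.Icc (0 : ℝ) 1) : ‖γ t - γ u‖ ^ 2 ≤ W * |u - t| := by
  rcases le_total t u with htu | htu
  · rw [abs_of_nonneg (by linarith)]
    exact norm_sq_le_of_dilation_le hW h ht.1 htu hu.2
  · rw [abs_of_nonpos (by linarith), norm_sub_rev, neg_sub]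
    exact norm_sq_le_of_dilation_le hW h hu.1 htu ht.2

/-- A curve of dilation at most `4.1` that is decomposed into at least nine fractions gives a
lattice trace, so there is none. -/
theorem not_dilation_le {γ : ℝ → EuclideanSpace ℝ (Fin 2)} (hγ : IsSurjectiveCurve 2 γ) {s : ℕ}
    (hs : 9 ≤ s ^ 2) (hd : IsDecomposed 2 γ s) :
    ¬dilation 2 0 1 γ ≤ ENNReal.ofReal (4 + 1 / 10) := by
  intro hdil
  have hs0 : 0 < s := by
    rcases Nat.eq_zero_or_pos s with rfl | h
    · norm_num at hs
    · exact h
  have hs' : (0 : ℝ) < s := by exact_mod_cast hs0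
  have hg : ((s ^ 2 : ℕ) : ℝ) = (s : ℝ) ^ 2 := by push_cast; ring
  choose j hj using fun k : Fin (s ^ 2) => hd k k.2
  have hinj := injective_of_isDecomposed hγ hs0 hj
  have hcell : ∀ k : ℕ, ∃ c : Fin 2 → Fin s, ∀ hk : k < s ^ 2, c = j ⟨k, hk⟩ := fun k => by
    by_cases hk : k < s ^ 2
    · exact ⟨j ⟨k, hk⟩, fun _ => rfl⟩
    · exact ⟨fun _ => ⟨0, hs0⟩, fun h => absurd h hk⟩
  choose c hc using hcell
  have hcimg : ∀ k : ℕ, k < 9 → γ '' timeSegment (s ^ 2) k = gridCube 2 s (c k) := fun k hk => by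
    rw [hc k (by omega)]
    exact hj ⟨k, by omega⟩
  let q : ℕ → ℤ × ℤ := fun k => (((c k 0 : ℕ) : ℤ), ((c k 1 : ℕ) : ℤ))
  have hvisit : ∀ (k : ℕ) (v : ℤ × ℤ), ∃ t : ℝ, k < 9 → IsCorner (q k) v →
      t ∈ timeSegment (s ^ 2) k ∧ γ t = !₂[(v.1 : ℝ) / s, (v.2 : ℝ) / s] := by
    intro k v
    by_cases h : k < 9 ∧ IsCorner (q k) v
    · obtain ⟨hk, h1, h2⟩ := h
      have hmem : !₂[(v.1 : ℝ) / s, (v.2 : ℝ) / s] ∈ gridCube 2 s (c k) := by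
        have hcoord : ∀ (a : ℕ) (b : ℤ), b = a ∨ b = a + 1 →
            (a : ℝ) / s ≤ (b : ℝ) / s ∧ (b : ℝ) / s ≤ ((a : ℝ) + 1) / s := by
          rintro a b (rfl | rfl) <;> push_cast <;> constructor <;> gcongr <;> linarith
        intro i
        fin_cases i
        · simpa using hcoord _ _ h1
        · simpa using hcoord _ _ h2
      rw [← hcimg k hk] at hmem
      obtain ⟨t, ht, hte⟩ := hmem
      exact ⟨t, fun _ _ => ⟨ht, hte⟩⟩
    · exact ⟨0, fun h1 h2 => absurd ⟨h1, h2⟩ h⟩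
  choose t ht using hvisit
  have hseg : ∀ k : ℕ, k < 9 → ∀ v, IsCorner (q k) v →
      (k : ℝ) ≤ (s : ℝ) ^ 2 * t k v ∧ (s : ℝ) ^ 2 * t k v ≤ (k : ℝ) + 1 := fun k hk v hv => by
    have := (ht k v hk hv).1
    rw [timeSegment, hg, Set.mem_Icc, div_le_iff₀' (by positivity),
      le_div_iff₀' (by positivity)] at this
    exact this
  have hunit : ∀ k : ℕ, k < 9 → ∀ v, IsCorner (q k) v → t k v ∈ Set.Icc (0 : ℝ) 1 := by
    intro k hk v hv
    have h1 := hseg k hk v hv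
    have h2 : (k : ℝ) + 1 ≤ (s : ℝ) ^ 2 := by exact_mod_cast (by omega : k + 1 ≤ s ^ 2)
    have h3 : (0 : ℝ) < (s : ℝ) ^ 2 := by positivity
    constructor
    · exact nonneg_of_mul_nonneg_right (le_trans (Nat.cast_nonneg k) h1.1) h3
    · exact le_of_mul_le_mul_left (by linarith) h3
  refine LatticeTrace.false (q := q) (T := fun k v => 41 * ((s : ℝ) ^ 2 * t k v))
    ⟨?_, ?_, ?_, ?_, ?_⟩
  · intro k hk
    have h1 : γ (((k : ℝ) + 1) / ((s ^ 2 : ℕ) : ℝ)) ∈ gridCube 2 s (c k) := by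
      rw [← hcimg k (by omega)]
      exact ⟨_, ⟨by gcongr; linarith, le_rfl⟩, rfl⟩
    have h2 : γ (((k : ℝ) + 1) / ((s ^ 2 : ℕ) : ℝ)) ∈ gridCube 2 s (c (k + 1)) := by
      rw [← hcimg (k + 1) (by omega)]
      exact ⟨_, ⟨by push_cast; exact le_rfl, by push_cast; gcongr; linarith⟩, rfl⟩
    exact ⟨abs_sub_le_one_of_common hs0 h1 h2 0, abs_sub_le_one_of_common hs0 h1 h2 1⟩
  · intro k hk l hl e
    have hkl : c k = c l := by
      simp only [q, Prod.mk.injEq, Nat.cast_inj] at e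
      funext i
      fin_cases i
      · exact Fin.ext e.1
      · exact Fin.ext e.2
    rw [hc k (by omega), hc l (by omega)] at hkl
    exact Fin.mk.inj_iff.1 (hinj hkl)
  · intro k hk v hv
    have := (hseg k hk v hv).1
    linarith
  · intro k hk v hv
    have := (hseg k hk v hv).2
    linarith
  · intro k hk l hl v w hv hw
    have h1 := norm_sq_le_mul_abs_of_dilation_le (by norm_num) hdil (hunit k hk v hv)
      (hunit l hl w hw)
    rw [(ht k v hk hv).2, (ht l w hl hw).2, EuclideanSpace.norm_sq_eq, Fin.sum_univ_two] at h1
    simp only [PiLp.sub_apply, Real.norm_eq_abs, sq_abs] at h1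
    have h2 : (((v.1 : ℝ) / s - (w.1 : ℝ) / s) ^ 2 + ((v.2 : ℝ) / s - (w.2 : ℝ) / s) ^ 2)
        * (s : ℝ) ^ 2 = (latticeSqDist v w : ℝ) := by
      simp only [latticeSqDist]
      push_cast
      field_simp
    have h3 : |41 * ((s : ℝ) ^ 2 * t l w) - 41 * ((s : ℝ) ^ 2 * t k v)|
        = 41 * (|t l w - t k v| * (s : ℝ) ^ 2) := by
      rw [← mul_sub, ← mul_sub, abs_mul, abs_mul,
        abs_of_pos (by positivity : (0 : ℝ) < (s : ℝ) ^ 2),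
        abs_of_pos (by norm_num : (0 : ℝ) < 41), mul_comm (|t l w - t k v|)]
    have h4 : (((v.1 : ℝ) / s - (w.1 : ℝ) / s) ^ 2 + ((v.2 : ℝ) / s - (w.2 : ℝ) / s) ^ 2)
        * (s : ℝ) ^ 2 ≤ (4 + 1 / 10) * |t l w - t k v| * (s : ℝ) ^ 2 :=
      mul_le_mul_of_nonneg_right h1 (by positivity)
    rw [h2] at h4
    rw [h3]
    linarith

end CubeCurve

theorem theorem3 :
    ∃ ε : ℝ, 0 < ε ∧
      ∀ γ : ℝ → EuclideanSpace ℝ (Fin 2), CubeCurve.IsCubicallyDecomposable 2 γ →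
        ENNReal.ofReal (4 + ε) ≤ CubeCurve.dilation 2 0 1 γ := by
  refine ⟨1 / 10, by norm_num, fun γ hγ => ?_⟩
  obtain ⟨s, hs, hd⟩ := hγ.decomposed 8
  exact (not_le.1 (CubeCurve.not_dilation_le hγ.surjectiveCurve hs hd)).le
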